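/- Let $\mathbb{O}$ be the algebra of octonions, $\mathbb{S}=\{J\in\mathbb{O} : J^2=-1\}$, and $\mathbb{O}_{\mathbb{C}}=\mathbb{O}\otimes_{\mathbb{R}}\mathbb{C}=\mathbb{O}+i\mathbb{O}$, with complex structure given by multiplication by $i$ and conjugation $\overline{x+iy}=x-iy$ $(x,y\in\mathbb{O})$. Let $D\subseteq\mathbb{C}^n$ be an open set (for instance a domain) and let $$\Omega_D=\{\alpha+\beta J : J\in\mathbb{S},\ \alpha,\beta\in\mathbb{R}^n,\ \alpha+i\beta\in D\}\subseteq\mathbb{O}^n .$$ A stem function on $D$ is a function $F=F_1+iF_2:D\to\mathbb{O}_{\mathbb{C}}$ with $F(\bar z)=\overline{F(z)}$ whenever $z,\bar z\in D$ ($D$ need not be invariant under conjugation). It induces the slice function $f=\mathcal{I}(F):\Omega_D\to\mathbb{O}$, $f(\alpha+\beta J)=F_1(z)+JF_2(z)$ for $J\in\mathbb{S}$ and $z=\alpha+i\beta\in D$. An $\mathbb{O}_{\mathbb{C}}$-valued function on an open subset of $\mathbb{C}^m$ is called holomorphic if it is of class $C^1$ and $$\frac{\partial F}{\partial\bar z_t}=\frac12\Big(\frac{\partial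 F}{\partial\alpha_t}+i\,\frac{\partial F}{\partial\beta_t}\Big)=0\qquad (t=1,\dots,m).$$ A function $f:\Omega_D\to\mathbb{O}$ is slice regular, written $f\in\mathcal{SR}(\Omega_D,\mathbb{O})$, if $f=\mathcal{I}(F)$ for some holomorphic stem function $F$ on $D$. For $a\in\mathbb{C}^n$ and $1\le j\le n$ put $$D_{j,a}=\{u\in\mathbb{C} : (a_1,\dots,a_{j-1},u,a_{j+1},\dots,a_n)\in D\},\qquad F_{j,a}(u)=F(a_1,\dots,a_{j-1},u,a_{j+1},\dots,a_n)\quad(u\in D_{j,a}).$$ **Theorem.** Let $f=\mathcal{I}(F):\Omega_D\to\mathbb{O}$ be the slice function induced by a stem function $F$ on $D$. Suppose that $f$ is slice regular in each variable separately, in the sense that for every $a\in\mathbb{C}^n$ and every $j=1,\dots,n$ the function $F_{j,a}:D_{j,a}\to\mathbb{O}_{\mathbb{C}}$ is holomorphic (it is not required to be a stem function itself). Then $f\in\mathcal{SR}(\Omega_D,\mathbb{O})$. -/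

import Mathlib

noncomputable section

namespace SliceOctonion

/-- The octonions `𝕆`, as the Cayley-Dickson double `ℍ ⊕ ℍ` of the real quaternions, with the
Euclidean norm of `ℝ⁸`. -/
def Octonion : Type := WithLp 2 (Quaternion ℝ × Quaternion ℝ)

namespace Octonion

instance : NormedAddCommGroup Octonion :=
  inferInstanceAs (NormedAddCommGroup (WithLp 2 (Quaternion ℝ × Quaternion ℝ)))

instance : NormedSpace ℝ Octonion :=
  inferInstanceAs (NormedSpace ℝ (WithLp 2 (Quaternion ℝ × Quaternion ℝ)))

/-- The octonion `(a, b) = a + b ℓ`. -/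
def mk (a b : Quaternion ℝ) : Octonion := WithLp.toLp 2 (a, b)

/-- First quaternionic component. -/
def fst (x : Octonion) : Quaternion ℝ := (WithLp.ofLp x).1

/-- Second quaternionic component. -/
def snd (x : Octonion) : Quaternion ℝ := (WithLp.ofLp x).2

instance : One Octonion := ⟨mk 1 0⟩

/-- The Cayley-Dickson product `(a, b)(c, d) = (a c - d̄ b, d a + b c̄)`. -/
instance : Mul Octonion :=
  ⟨fun x y => mk (x.fst * y.fst - star y.snd * x.snd) (y.snd * x.fst + x.snd * star y.fst)⟩

end Octonion

/-- The complexification `𝕆_ℂ = 𝕆 ⊗_ℝ ℂ = 𝕆 + i 𝕆` of the octonions, as a real normed space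
(the element `x + i y` is the pair `(x, y)`). -/
def OctonionC : Type := WithLp 2 (Octonion × Octonion)

namespace OctonionC

instance : NormedAddCommGroup OctonionC :=
  inferInstanceAs (NormedAddCommGroup (WithLp 2 (Octonion × Octonion)))

instance : NormedSpace ℝ OctonionC :=
  inferInstanceAs (NormedSpace ℝ (WithLp 2 (Octonion × Octonion)))

/-- The element `x + i y`. -/
def mk (x y : Octonion) : OctonionC := WithLp.toLp 2 (x, y)

/-- The component `x` of `x + i y`. -/
def re (w : OctonionC) : Octonion := (WithLp.ofLp w).1

/-- The component `y` of `x + i y`. -/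
def im (w : OctonionC) : Octonion := (WithLp.ofLp w).2

/-- Complex conjugation `x + i y ↦ x - i y`. -/
def conj (w : OctonionC) : OctonionC := mk w.re (-w.im)

/-- Left multiplication by `i`, the complex structure of `𝕆_ℂ`: `i (x + i y) = -y + i x`. -/
def mulI (w : OctonionC) : OctonionC := mk (-w.im) w.re

end OctonionC

/-- The sphere `𝕊 = {J ∈ 𝕆 | J² = -1}` of imaginary units. -/
def imagUnits : Set Octonion := {J | J * J = -1}

variable {n : ℕ}

/-- The map `φ_J : ℂⁿ → ℂ_Jⁿ ⊆ 𝕆ⁿ`, `α + i β ↦ α + β J`. -/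
def phi (J : Octonion) (z : Fin n → ℂ) : Fin n → Octonion :=
  fun t => (z t).re • (1 : Octonion) + (z t).im • J

/-- The circular set `Ω_D = {α + β J | J ∈ 𝕊, α + i β ∈ D} ⊆ 𝕆ⁿ`. -/
def circularSet (D : Set (Fin n → ℂ)) : Set (Fin n → Octonion) :=
  {x | ∃ J ∈ imagUnits, ∃ z ∈ D, x = phi J z}

/-- Coordinatewise complex conjugation on `ℂⁿ`. -/
def conjVec (z : Fin n → ℂ) : Fin n → ℂ := fun t => starRingEnd ℂ (z t)

/-- `F` is an `𝕆`-stem function on `D`: it is complex intrinsic, `F(z̄) = conj (F(z))`.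
No symmetry of `D` is assumed; the condition is imposed whenever `z` and `z̄` both lie in `D`. -/
def IsStem (D : Set (Fin n → ℂ)) (F : (Fin n → ℂ) → OctonionC) : Prop :=
  ∀ z ∈ D, conjVec z ∈ D → F (conjVec z) = (F z).conj

/-- `f = 𝓘(F)` on `Ω_D`: `f(α + J β) = F₁(z) + J F₂(z)` for all `J ∈ 𝕊` and
`z = α + i β ∈ D`. -/
def IsInducedBy (D : Set (Fin n → ℂ)) (F : (Fin n → ℂ) → OctonionC)
    (f : circularSet D → Octonion) : Prop :=
  ∀ x : circularSet D, ∀ J ∈ imagUnits, ∀ z ∈ D,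
    (x : Fin n → Octonion) = phi J z → f x = (F z).re + J * (F z).im

/-- `∂F/∂z̄_t = ½ (∂F/∂α_t + i ∂F/∂β_t)`. -/
def dbar (F : (Fin n → ℂ) → OctonionC) (t : Fin n) (z : Fin n → ℂ) : OctonionC :=
  (1 / 2 : ℝ) • (fderiv ℝ F z (Pi.single t 1) + (fderiv ℝ F z (Pi.single t Complex.I)).mulI)

/-- `F` is holomorphic on the open set `D`: `F` is of class `C¹` on `D` and `∂F/∂z̄_t = 0` on `D`
for every `t`. -/
def IsHolomorphic (D : Set (Fin n → ℂ)) (F : (Fin n → ℂ) → OctonionC) : Prop :=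
  ContDiffOn ℝ 1 F D ∧ ∀ z ∈ D, ∀ t, dbar F t z = 0

/-- `f ∈ 𝓢𝓡(Ω_D, 𝕆)`: `f` is slice regular, that is `f = 𝓘(F)` for a stem function `F` on `D`
that is holomorphic on `D`. -/
def IsSliceRegular (D : Set (Fin n → ℂ)) (f : circularSet D → Octonion) : Prop :=
  ∃ F : (Fin n → ℂ) → OctonionC, IsStem D F ∧ IsInducedBy D F f ∧ IsHolomorphic D F

/-- The slice `D_{j,a} = {u ∈ ℂ | (a₁, …, a_{j-1}, u, a_{j+1}, …, a_n) ∈ D}`, with `ℂ` written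
as `ℂ¹`. -/
def sliceSet (D : Set (Fin n → ℂ)) (j : Fin n) (a : Fin n → ℂ) : Set (Fin 1 → ℂ) :=
  {u | Function.update a j (u 0) ∈ D}

/-- The restriction `F_{j,a}(u) = F(a₁, …, a_{j-1}, u, a_{j+1}, …, a_n)`. -/
def sliceFun (F : (Fin n → ℂ) → OctonionC) (j : Fin n) (a : Fin n → ℂ) :
    (Fin 1 → ℂ) → OctonionC :=
  fun u => F (Function.update a j (u 0))

end SliceOctonion

end

open SliceOctonion

/-! The stem function `F` itself witnesses slice regularity, so everything reduces to Hartogs'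
theorem for `F`. Holomorphy into `𝕆_ℂ` involves only its real vector space structure and
multiplication by `i`. Each real linear form on `𝕆` therefore turns `F` into a separately
holomorphic scalar function, and finitely many forms recover `F`.

Scalar Hartogs on `E × ℂ`: Baire's theorem bounds `u` on a product that is thin in the `E` direction
but wide in the `ℂ` direction, and Osgood's lemma makes `u` jointly holomorphic there. Expand `u`
along complex lines through the thin centre. The Taylor coefficients are holomorphic in `w`, grow at
most geometrically, and are bounded at each fixed `w`. Hartogs' lemma, which rests on the sub-mean
value property of `log ‖f‖`, makes their growth rate uniformly close to `1`. The series then bounds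
`u` on a wide product containing the original point, and Osgood's lemma applies again. Induction on
the number of variables gives `ℂⁿ`. -/

/-! ### Schwarz and Cauchy estimates, and Osgood's lemma. -/

section Osgood

open Metric Set Filter Topology

variable {E E₁ E₂ G : Type*} [NormedAddCommGroup E] [NormedSpace ℂ E]
  [NormedAddCommGroup E₁] [NormedSpace ℂ E₁] [NormedAddCommGroup E₂] [NormedSpace ℂ E₂]
  [NormedAddCommGroup G] [NormedSpace ℂ G]

/-- A bounded holomorphic function is Lipschitz on a smaller ball. -/
theorem norm_sub_le_of_differentiableOn_ball {f : E → G} {c x y : E} {R M : ℝ}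
    (hf : DifferentiableOn ℂ f (ball c R)) (hM : ∀ z ∈ ball c R, ‖f z‖ ≤ M)
    (hx : x ∈ ball c (R / 4)) (hy : y ∈ ball c (R / 4)) :
    ‖f x - f y‖ ≤ 4 * M / R * ‖x - y‖ := by
  have hR : 0 < R := by have := pos_of_mem_ball hx; linarith
  have hsub : ball y (R / 2) ⊆ ball c R := by
    apply ball_subset_ball'
    have := mem_ball.1 hy
    linarith
  have hyc : y ∈ ball c R := hsub (mem_ball_self (by positivity))
  -- Schwarz's lemma on `ball y (R / 2)`: values stay within `2 * M` of `f y`, and `2 * M / (R / 2)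
  -- = 4 * M / R`.
  have key := Complex.dist_le_div_mul_dist_of_mapsTo_ball (R₂ := 2 * M) (hf.mono hsub)
    (fun z hz ↦ by
      rw [mem_closedBall, dist_eq_norm]
      have h1 := hM z (hsub hz)
      have h2 := hM y hyc
      have h3 := norm_sub_le (f z) (f y)
      linarith)
    (z := x) (by
      rw [mem_ball] at hx hy ⊢
      have := dist_triangle_right x y c
      linarith)
  rw [dist_eq_norm, dist_eq_norm] at key
  convert key using 2
  field_simp
  ring

/-- Cauchy's estimate for the difference of the derivatives of two holomorphic functions that are
close to each other after translation. -/
theorem norm_fderiv_sub_fderiv_le {f g : E → G} {x y : E} {R η : ℝ} (hR : 0 < R)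
    (hf : DifferentiableOn ℂ f (ball x R)) (hg : DifferentiableOn ℂ g (ball y R))
    (hη : ∀ ζ ∈ ball (0 : E) R, ‖f (x + ζ) - g (y + ζ)‖ ≤ η) :
    ‖fderiv ℂ f x - fderiv ℂ g y‖ ≤ 2 * η / R := by
  have hmap (a : E) : MapsTo (fun ζ ↦ a + ζ) (ball (0 : E) R) (ball a R) := by
    intro ζ hζ
    simpa using hζ
  have hd : DifferentiableOn ℂ (fun ζ ↦ f (x + ζ) - g (y + ζ)) (ball (0 : E) R) :=
    (hf.comp (by fun_prop) (hmap x)).sub (hg.comp (by fun_prop) (hmap y))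
  have key := Complex.norm_fderiv_le_div_of_mapsTo_ball (R₂ := 2 * η) hd
    (fun ζ hζ ↦ by
      rw [mem_closedBall, dist_eq_norm]
      have h1 := hη ζ hζ
      have h2 := hη 0 (mem_ball_self hR)
      have h3 := norm_sub_le (f (x + ζ) - g (y + ζ)) (f (x + 0) - g (y + 0))
      linarith) hR
  have hfx : DifferentiableAt ℂ f (x + 0) := by
    simpa using hf.differentiableAt (ball_mem_nhds x hR)
  have hgy : DifferentiableAt ℂ g (y + 0) := by
    simpa using hg.differentiableAt (ball_mem_nhds y hR)
  have hsub := fderiv_fun_sub (𝕜 := ℂ) (x := (0 : E)) (f := fun ζ ↦ f (x + ζ))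
    (g := fun ζ ↦ g (y + ζ)) (hfx.comp (0 : E) (by fun_prop)) (hgy.comp (0 : E) (by fun_prop))
  rwa [hsub, fderiv_comp_add_left, fderiv_comp_add_left, add_zero, add_zero] at key

/-- The derivative of a holomorphic function on an open subset of a normed space is continuous. -/
theorem DifferentiableOn.continuousOn_fderiv_complex {f : E → G} {s : Set E} (hs : IsOpen s)
    (hf : DifferentiableOn ℂ f s) : ContinuousOn (fderiv ℂ f) s := by
  intro c hc
  apply ContinuousAt.continuousWithinAt
  have hcont : ContinuousAt f c := (hf.differentiableAt (hs.mem_nhds hc)).continuousAt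
  have hev : ∀ᶠ z in 𝓝 c, z ∈ s ∧ ‖f z‖ < ‖f c‖ + 1 :=
    (hs.eventually_mem hc).and (hcont.norm.eventually (gt_mem_nhds (by linarith)))
  obtain ⟨R, hR, hball⟩ := Metric.eventually_nhds_iff_ball.1 hev
  set M := ‖f c‖ + 1
  have hfd : DifferentiableOn ℂ f (ball c R) := hf.mono fun z hz ↦ (hball z hz).1
  have hlim : Tendsto (fun x ↦ 2 * (4 * M / R * ‖x - c‖) / (R / 8)) (𝓝 c) (𝓝 0) := by
    have : Continuous fun x : E ↦ 2 * (4 * M / R * ‖x - c‖) / (R / 8) := by fun_prop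
    simpa using this.tendsto c
  rw [ContinuousAt, tendsto_iff_norm_sub_tendsto_zero]
  refine squeeze_zero' (Eventually.of_forall fun _ ↦ norm_nonneg _) ?_ hlim
  -- With `x - c` and `ζ` both shorter than `R / 8`, the translates `x + ζ` and `c + ζ` stay in
  -- `ball c (R / 4)`, where `f` is Lipschitz.
  filter_upwards [ball_mem_nhds c (show 0 < R / 8 by positivity)] with x hx
  have hx' := mem_ball.1 hx
  apply norm_fderiv_sub_fderiv_le (by positivity)
  · exact hfd.mono (ball_subset_ball' (by linarith))
  · exact hfd.mono (ball_subset_ball (by linarith))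
  · intro ζ hζ
    have hζ' : ‖ζ‖ < R / 8 := by simpa using hζ
    have := norm_sub_le_of_differentiableOn_ball hfd (fun z hz ↦ (hball z hz).2.le)
      (x := x + ζ) (y := c + ζ)
      (by
        rw [mem_ball, dist_eq_norm] at hx ⊢
        have := norm_add_le (x - c) ζ
        rw [show x + ζ - c = x - c + ζ by abel]
        linarith)
      (by simp; linarith)
    simpa using this

/-- **Osgood's lemma**: a bounded separately holomorphic function on a product of two balls is
holomorphic at the centre. -/
theorem differentiableAt_of_separately_of_bounded {u : E₁ × E₂ → G} {c : E₁ × E₂} {R M : ℝ}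
    (hR : 0 < R)
    (h₁ : ∀ w ∈ ball c.2 R, DifferentiableOn ℂ (fun z ↦ u (z, w)) (ball c.1 R))
    (h₂ : ∀ z ∈ ball c.1 R, DifferentiableOn ℂ (fun w ↦ u (z, w)) (ball c.2 R))
    (hM : ∀ z ∈ ball c.1 R, ∀ w ∈ ball c.2 R, ‖u (z, w)‖ ≤ M) :
    DifferentiableAt ℂ u c := by
  -- Moving one variable at a time gives a joint Lipschitz bound. Through Cauchy's estimate it makes
  -- both partial derivatives continuous at `c` in the pair of variables, which yields strict
  -- differentiability.
  have hlip : ∀ z ∈ ball c.1 (R / 4), ∀ z' ∈ ball c.1 (R / 4), ∀ w ∈ ball c.2 (R / 4),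
      ∀ w' ∈ ball c.2 (R / 4),
      ‖u (z, w) - u (z', w')‖ ≤ 4 * M / R * (‖z - z'‖ + ‖w - w'‖) := by
    intro z hz z' hz' w hw w' hw'
    have hle : R / 4 ≤ R := by linarith
    have a := norm_sub_le_of_differentiableOn_ball (h₁ w (ball_subset_ball hle hw))
      (fun z hz ↦ hM z hz w (ball_subset_ball hle hw)) hz hz'
    have b := norm_sub_le_of_differentiableOn_ball (h₂ z' (ball_subset_ball hle hz'))
      (fun w hw ↦ hM z' (ball_subset_ball hle hz') w hw) hw hw'
    calc ‖u (z, w) - u (z', w')‖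
        = ‖(u (z, w) - u (z', w)) + (u (z', w) - u (z', w'))‖ := by congr 1; abel
      _ ≤ _ := norm_add_le _ _
      _ ≤ _ := by rw [mul_add]; exact add_le_add a b
  have hlim : Tendsto (fun p : E₁ × E₂ ↦ 2 * (4 * M / R * (‖p.1 - c.1‖ + ‖p.2 - c.2‖)) / (R / 8))
      (𝓝 c) (𝓝 0) := by
    have : Continuous fun p : E₁ × E₂ ↦
      2 * (4 * M / R * (‖p.1 - c.1‖ + ‖p.2 - c.2‖)) / (R / 8) := by fun_prop
    simpa using this.tendsto c
  have hnhds : ∀ᶠ p in 𝓝 c, p.1 ∈ ball c.1 (R / 8) ∧ p.2 ∈ ball c.2 (R / 8) := by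
    have := prod_mem_nhds (ball_mem_nhds c.1 (show 0 < R / 8 by positivity))
      (ball_mem_nhds c.2 (show 0 < R / 8 by positivity))
    exact this
  refine (hasStrictFDerivAt_uncurry_coprod (𝕜 := ℂ) (u := c) (f := fun z w ↦ u (z, w))
    (f₁ := fun z w ↦ fderiv ℂ (fun z ↦ u (z, w)) z)
    (f₂ := fun z w ↦ fderiv ℂ (fun w ↦ u (z, w)) w) ?_ ?_ ?_ ?_).hasFDerivAt.differentiableAt
  · filter_upwards [hnhds] with p hp
    exact ((h₁ p.2 (ball_subset_ball (by linarith) hp.2)).differentiableAt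
      (isOpen_ball.mem_nhds (ball_subset_ball (by linarith) hp.1))).hasFDerivAt
  · filter_upwards [hnhds] with p hp
    exact ((h₂ p.1 (ball_subset_ball (by linarith) hp.1)).differentiableAt
      (isOpen_ball.mem_nhds (ball_subset_ball (by linarith) hp.2))).hasFDerivAt
  · rw [ContinuousAt, tendsto_iff_norm_sub_tendsto_zero]
    refine squeeze_zero' (Eventually.of_forall fun _ ↦ norm_nonneg _) ?_ hlim
    filter_upwards [hnhds] with p hp
    have hp1 := mem_ball.1 hp.1
    have hp2 := mem_ball.1 hp.2
    refine norm_fderiv_sub_fderiv_le (f := fun z ↦ u (z, p.2)) (g := fun z ↦ u (z, c.2))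
      (by positivity) ((h₁ p.2 (ball_subset_ball (by linarith) hp.2)).mono
        (ball_subset_ball' (by linarith)))
      ((h₁ c.2 (mem_ball_self hR)).mono (ball_subset_ball (by linarith))) fun ζ hζ ↦ ?_
    have hζ' : ‖ζ‖ < R / 8 := by simpa using hζ
    have := hlip (p.1 + ζ) (by
        rw [dist_eq_norm] at hp1
        rw [mem_ball, dist_eq_norm, show p.1 + ζ - c.1 = p.1 - c.1 + ζ by abel]
        have := norm_add_le (p.1 - c.1) ζ
        linarith) (c.1 + ζ) (by simp; linarith) p.2 (ball_subset_ball (by linarith) hp.2) c.2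
        (mem_ball_self (by positivity))
    simpa using this
  · rw [ContinuousAt, tendsto_iff_norm_sub_tendsto_zero]
    refine squeeze_zero' (Eventually.of_forall fun _ ↦ norm_nonneg _) ?_ hlim
    filter_upwards [hnhds] with p hp
    have hp1 := mem_ball.1 hp.1
    have hp2 := mem_ball.1 hp.2
    refine norm_fderiv_sub_fderiv_le (f := fun w ↦ u (p.1, w)) (g := fun w ↦ u (c.1, w))
      (by positivity) ((h₂ p.1 (ball_subset_ball (by linarith) hp.1)).mono
        (ball_subset_ball' (by linarith)))
      ((h₂ c.1 (mem_ball_self hR)).mono (ball_subset_ball (by linarith))) fun ζ hζ ↦ ?_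
    have hζ' : ‖ζ‖ < R / 8 := by simpa using hζ
    have := hlip p.1 (ball_subset_ball (by linarith) hp.1) c.1
        (mem_ball_self (by positivity)) (p.2 + ζ) (by
        rw [dist_eq_norm] at hp2
        rw [mem_ball, dist_eq_norm, show p.2 + ζ - c.2 = p.2 - c.2 + ζ by abel]
        have := norm_add_le (p.2 - c.2) ζ
        linarith) (c.2 + ζ) (by simp; linarith)
    simpa using this

end Osgood

/-! ### Holomorphic dependence of Taylor coefficients on a parameter. -/

section ParameterDerivative

open Metric Set Filter Topology MeasureTheory
open scoped Real ENNReal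

/-- The Taylor coefficients in the first variable of a bounded holomorphic function of two variables
depend holomorphically on the second variable. -/
theorem differentiableOn_iteratedDeriv_fst {G : ℂ × ℂ → ℂ} {w₀ : ℂ} {r ρ M : ℝ} (hr : 0 < r)
    (hG : DifferentiableOn ℂ G (ball 0 r ×ˢ ball w₀ ρ))
    (hM : ∀ p ∈ ball (0 : ℂ) r ×ˢ ball w₀ ρ, ‖G p‖ ≤ M) (k : ℕ) :
    DifferentiableOn ℂ (fun w ↦ iteratedDeriv k (fun z ↦ G (z, w)) 0) (ball w₀ ρ) := by
  have hr2 : 0 < r / 2 := by positivity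
  have hopen : IsOpen (ball (0 : ℂ) r ×ˢ ball w₀ ρ) := isOpen_ball.prod isOpen_ball
  have hcirc (θ : ℝ) : circleMap 0 (r / 2) θ ∈ ball (0 : ℂ) r := by
    simp [abs_of_pos hr2, hr]
  have hcauchy : ∀ w ∈ ball w₀ ρ, iteratedDeriv k (fun z ↦ G (z, w)) 0 =
      (2 * π * Complex.I / k.factorial)⁻¹ •
        ∮ z in C(0, r / 2), (1 / (z - 0) ^ (k + 1)) • G (z, w) := by
    intro w hw
    rw [DifferentiableOn.circleIntegral_one_div_sub_center_pow_smul hr2 k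
      (f := fun z ↦ G (z, w)), inv_smul_smul₀]
    · simp [Nat.factorial_ne_zero]
    · refine hG.comp (by fun_prop) fun z hz ↦ ⟨?_, hw⟩
      exact closedBall_subset_ball (by linarith) hz
  refine DifferentiableOn.congr ?_ hcauchy
  intro w hw
  apply DifferentiableAt.differentiableWithinAt
  refine DifferentiableAt.fun_const_smul ?_ _
  obtain ⟨δ, hδ, hsub⟩ := Metric.isOpen_iff.1 isOpen_ball w hw
  set a : ℝ → ℂ := fun θ ↦
    deriv (circleMap 0 (r / 2)) θ * (1 / (circleMap 0 (r / 2) θ - 0) ^ (k + 1)) with ha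
  have hac : Continuous a := by
    have h0 (θ : ℝ) : circleMap 0 (r / 2) θ - 0 ≠ 0 := by
      simpa using circleMap_ne_center hr2.ne' (c := 0) (θ := θ)
    simp only [ha, deriv_circleMap]
    exact ((continuous_circleMap 0 _).mul continuous_const).mul
      (continuous_const.div (((continuous_circleMap 0 _).sub continuous_const).pow _)
        fun θ ↦ pow_ne_zero _ (h0 θ))
  have hGc (x : ℂ) (hx : x ∈ ball w₀ ρ) :
      Continuous fun θ : ℝ ↦ a θ * G (circleMap 0 (r / 2) θ, x) :=
    hac.mul (hG.continuousOn.comp_continuous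
      ((continuous_circleMap 0 _).prodMk continuous_const) fun θ ↦ ⟨hcirc θ, hx⟩)
  -- Differentiation under Cauchy's integral. The dominating Lipschitz constant `4 * M / δ` on `ball
  -- w (δ / 4)` comes from the Schwarz estimate on `ball w δ`.
  have hderiv := intervalIntegral.hasDerivAt_integral_of_dominated_loc_of_lip (μ := volume)
    (a := 0) (b := 2 * π) (x₀ := w) (s := ball w (δ / 4))
    (F := fun x θ ↦ a θ * G (circleMap 0 (r / 2) θ, x))
    (F' := fun θ ↦ a θ * fderiv ℂ G (circleMap 0 (r / 2) θ, w) (0, 1))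
    (bound := fun θ ↦ ‖a θ‖ * (4 * M / δ)) (ball_mem_nhds w (by positivity)) ?_ ?_ ?_ ?_ ?_ ?_
  · refine hderiv.2.differentiableAt.congr_of_eventuallyEq (Eventually.of_forall fun x ↦ ?_)
    simp [circleIntegral, ha, mul_assoc]
  · filter_upwards [isOpen_ball.mem_nhds hw] with x hx
    exact (hGc x hx).aestronglyMeasurable
  · exact (hGc w hw).intervalIntegrable _ _
  · refine Continuous.aestronglyMeasurable (hac.mul ?_)
    exact ((hG.continuousOn_fderiv_complex hopen).comp_continuous
      ((continuous_circleMap 0 _).prodMk continuous_const) fun θ ↦ ⟨hcirc θ, hw⟩).clm_apply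
      continuous_const
  · refine Eventually.of_forall fun θ _ ↦ ?_
    have hMnn : 0 ≤ M := (norm_nonneg _).trans (hM (circleMap 0 (r / 2) θ, w) ⟨hcirc θ, hw⟩)
    refine LipschitzOnWith.of_dist_le_mul fun x hx y hy ↦ ?_
    rw [dist_eq_norm, dist_eq_norm, ← mul_sub, norm_mul, Real.coe_nnabs,
      abs_of_nonneg (by positivity), mul_assoc]
    gcongr
    refine norm_sub_le_of_differentiableOn_ball (f := fun x ↦ G (circleMap 0 (r / 2) θ, x))
      (hG.comp (by fun_prop) fun x hx ↦ ⟨hcirc θ, hsub hx⟩)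
      (fun x hx ↦ hM _ ⟨hcirc θ, hsub hx⟩) hx hy
  · exact (hac.norm.mul continuous_const).intervalIntegrable _ _
  · refine Eventually.of_forall fun θ _ ↦ HasDerivAt.const_mul _ ?_
    have h1 := (hG.differentiableAt (hopen.mem_nhds
      (show (circleMap 0 (r / 2) θ, w) ∈ _ from ⟨hcirc θ, hw⟩))).hasFDerivAt
    exact h1.comp_hasDerivAt w ((hasDerivAt_const w _).prodMk (hasDerivAt_id w))

end ParameterDerivative

/-! ### The sub-mean value inequality for `log ‖f‖`. -/

section Submean

open Metric Set Filter Topology MeasureTheory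
open scoped Real ENNReal

/-- Jensen's inequality for the positive part of `log ‖f‖`. -/
theorem log_norm_le_circleAverage_posLog {f : ℂ → ℂ} {c : ℂ} {r : ℝ} (hr : 0 < r)
    (hf : AnalyticOnNhd ℂ f (closedBall c r)) :
    Real.log ‖f c‖ ≤ Real.circleAverage (fun z ↦ Real.posLog ‖f z‖) c r := by
  have habs : |r| = r := abs_of_pos hr
  have hcont : ContinuousOn (fun z ↦ Real.posLog ‖f z‖) (sphere c |r|) :=
    Real.continuous_posLog.comp_continuousOn
      (hf.continuousOn.mono (by rw [habs]; exact sphere_subset_closedBall)).norm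
  have hnn : 0 ≤ Real.circleAverage (fun z ↦ Real.posLog ‖f z‖) c r :=
    Real.circleAverage_nonneg_of_nonneg fun _ _ ↦ Real.posLog_nonneg
  -- Since `Real.log 0 = 0`, a zero at the centre only requires the average to be nonnegative.
  by_cases h0 : f c = 0
  · simpa [h0] using hnn
  have hf' : AnalyticOnNhd ℂ f (closedBall c |r|) := by rwa [habs]
  have hJ := hf'.circleAverage_log_norm hr.ne' h0
  -- The zeros of `f` in the disc contribute nonnegatively to Jensen's formula, so dropping them
  -- leaves an inequality.
  have hsum : 0 ≤ ∑ᶠ u, (MeromorphicOn.divisor f (closedBall c |r|) u : ℝ) *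
      Real.log (r * ‖c - u‖⁻¹) := by
    refine finsum_nonneg fun u ↦ ?_
    by_cases hu : u ∈ closedBall c |r|
    · refine mul_nonneg (mod_cast MeromorphicOn.AnalyticOnNhd.divisor_nonneg hf' u) ?_
      rcases eq_or_ne u c with rfl | hne
      · simp
      · apply Real.log_nonneg
        have hpos : 0 < ‖c - u‖ := by simpa [sub_eq_zero] using hne.symm
        rw [← div_eq_mul_inv, one_le_div hpos]
        simpa [habs, dist_eq_norm, norm_sub_rev] using hu
    · simp [hu]
  have hint : CircleIntegrable (fun z ↦ Real.log ‖f z‖) c r :=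
    MeromorphicOn.circleIntegrable_log_norm fun z hz ↦
      (hf' z (sphere_subset_closedBall hz)).meromorphicAt
  have hmono := Real.circleAverage_mono hint hcont.circleIntegrable'
    (fun z _ ↦ show Real.log ‖f z‖ ≤ Real.posLog ‖f z‖ from le_max_right _ _)
  linarith

/-- The sub-mean value inequality on circles, with a lower integral. -/
theorem ofReal_log_norm_mul_le_lintegral_angle {f : ℂ → ℂ} {c : ℂ} {r : ℝ} (hr : 0 < r)
    (hf : AnalyticOnNhd ℂ f (closedBall c r)) :
    ENNReal.ofReal (Real.log ‖f c‖) * volume (Ioo (-π) π) ≤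
      ∫⁻ θ in Ioo (-π) π, ENNReal.ofReal (Real.posLog ‖f (circleMap c r θ)‖) := by
  have hcont : Continuous fun θ : ℝ ↦ Real.posLog ‖f (circleMap c r θ)‖ :=
    Real.continuous_posLog.comp (hf.continuousOn.comp_continuous (continuous_circleMap c r)
      fun θ ↦ circleMap_mem_closedBall c hr.le θ).norm
  have hper : Function.Periodic (fun θ : ℝ ↦ Real.posLog ‖f (circleMap c r θ)‖) (2 * π) :=
    fun θ ↦ by simp [periodic_circleMap c r θ]
  have hint : IntegrableOn (fun θ : ℝ ↦ Real.posLog ‖f (circleMap c r θ)‖) (Ioo (-π) π) :=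
    (hcont.integrableOn_Icc (a := -π) (b := π)).mono_set Ioo_subset_Icc_self
  rw [← ofReal_integral_eq_lintegral_ofReal hint
    (Eventually.of_forall fun _ ↦ Real.posLog_nonneg), Real.volume_Ioo,
    ← ENNReal.ofReal_mul' (by linarith [Real.pi_pos])]
  apply ENNReal.ofReal_le_ofReal
  have h := log_norm_le_circleAverage_posLog hr hf
  -- Circle averages run over `[0, 2π]`, polar coordinates over `(-π, π)`; periodicity reconciles
  -- them.
  have hshift := hper.intervalIntegral_add_eq 0 (-π)
  rw [zero_add, show -π + 2 * π = π by ring] at hshift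
  rw [Real.circleAverage_def, hshift, smul_eq_mul,
    intervalIntegral.integral_of_le (by linarith [Real.pi_pos]), integral_Ioc_eq_integral_Ioo] at h
  calc Real.log ‖f c‖ * (π - -π) ≤ ((2 * π)⁻¹ * _) * (π - -π) := by
        gcongr
        linarith [Real.pi_pos]
    _ = _ := by
        field_simp
        ring

/-- The lower Lebesgue integral over a disc in polar coordinates. -/
theorem setLIntegral_ball_eq_polar {c : ℂ} {ρ : ℝ} {V : ℂ → ℝ≥0∞} (hV : Measurable V) :
    ∫⁻ z in ball c ρ, V z =
      ∫⁻ r in Ioo 0 ρ, ENNReal.ofReal r * ∫⁻ θ in Ioo (-π) π, V (circleMap c r θ) := by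
  have htrans : ∫⁻ z in ball c ρ, V z = ∫⁻ z, (ball (0 : ℂ) ρ).indicator (fun z ↦ V (c + z)) z := by
    rw [← lintegral_indicator measurableSet_ball, ← lintegral_add_left_eq_self _ c]
    refine lintegral_congr fun z ↦ ?_
    by_cases hz : z ∈ ball (0 : ℂ) ρ
    · rw [indicator_of_mem hz, indicator_of_mem (by simpa using hz)]
    · rw [indicator_of_notMem hz, indicator_of_notMem (by simpa using hz)]
  have hmeas : Measurable fun p : ℝ × ℝ ↦ V (circleMap c p.1 p.2) :=
    hV.comp (by unfold circleMap; fun_prop)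
  rw [htrans, ← Complex.lintegral_comp_polarCoord_symm, polarCoord_target]
  have hcongr : ∀ p ∈ Ioi (0 : ℝ) ×ˢ Ioo (-π) π, ENNReal.ofReal p.1 •
      (ball (0 : ℂ) ρ).indicator (fun z ↦ V (c + z)) (Complex.polarCoord.symm p) =
      (Iio ρ).indicator (fun r ↦ ENNReal.ofReal r) p.1 * V (circleMap c p.1 p.2) := by
    rintro ⟨r, θ⟩ ⟨hr, -⟩
    have hr' : 0 < r := hr
    have heq : Complex.polarCoord.symm (r, θ) = r * Complex.exp (θ * Complex.I) := by
      rw [Complex.polarCoord_symm_apply, Complex.exp_mul_I]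
      push_cast
      rfl
    rw [heq]
    by_cases hlt : r < ρ
    · rw [indicator_of_mem (by simpa [abs_of_pos hr'] using hlt),
        indicator_of_mem (show r ∈ Iio ρ from hlt), smul_eq_mul, circleMap]
    · rw [indicator_of_notMem (by simpa [abs_of_pos hr'] using hlt),
        indicator_of_notMem (show r ∉ Iio ρ from hlt)]
      simp
  rw [setLIntegral_congr_fun (measurableSet_Ioi.prod measurableSet_Ioo) hcongr,
    Measure.volume_eq_prod, ← Measure.prod_restrict, lintegral_prod]
  · have hinner (r : ℝ) : ∫⁻ θ in Ioo (-π) π,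
        (Iio ρ).indicator (fun r ↦ ENNReal.ofReal r) r * V (circleMap c r θ) =
        (Iio ρ).indicator
          (fun r ↦ ENNReal.ofReal r * ∫⁻ θ in Ioo (-π) π, V (circleMap c r θ)) r := by
      rw [lintegral_const_mul _ (show Measurable fun θ ↦ V (circleMap c r θ) from
        hmeas.comp measurable_prodMk_left)]
      by_cases hlt : r ∈ Iio ρ
      · simp only [indicator_of_mem hlt]
      · simp only [indicator_of_notMem hlt, zero_mul]
    simp only [hinner]
    rw [lintegral_indicator measurableSet_Iio, Measure.restrict_restrict measurableSet_Iio,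
      inter_comm, Ioi_inter_Iio]
  · exact (((ENNReal.measurable_ofReal.indicator measurableSet_Iio).comp measurable_fst).mul
      hmeas).aemeasurable

/-- The sub-mean value inequality for `log ‖f‖` on discs. -/
theorem ofReal_log_norm_mul_volume_ball_le {f : ℂ → ℂ} {c : ℂ} {ρ : ℝ}
    (hf : DifferentiableOn ℂ f (ball c ρ)) :
    ENNReal.ofReal (Real.log ‖f c‖) * volume (ball c ρ) ≤
      ∫⁻ z in ball c ρ, ENNReal.ofReal (Real.posLog ‖f z‖) := by
  -- Extension by zero gives a globally measurable integrand, as the polar formula requires.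
  set V : ℂ → ℝ≥0∞ := (ball c ρ).indicator fun z ↦ ENNReal.ofReal (Real.posLog ‖f z‖) with hVdef
  have hV : Measurable V := by
    have hc : ContinuousOn (fun z ↦ ENNReal.ofReal (Real.posLog ‖f z‖)) (ball c ρ) :=
      (ENNReal.continuous_ofReal.comp Real.continuous_posLog).comp_continuousOn
        hf.continuousOn.norm
    classical
    rw [hVdef, ← piecewise_eq_indicator]
    exact hc.measurable_piecewise continuousOn_const measurableSet_ball
  have hVeq : ∫⁻ z in ball c ρ, ENNReal.ofReal (Real.posLog ‖f z‖) = ∫⁻ z in ball c ρ, V z :=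
    setLIntegral_congr_fun measurableSet_ball fun z hz ↦ by
      rw [hVdef, indicator_of_mem hz]
  have hconst : ENNReal.ofReal (Real.log ‖f c‖) * volume (ball c ρ) =
      ∫⁻ z in ball c ρ, (fun _ ↦ ENNReal.ofReal (Real.log ‖f c‖)) z := by
    rw [setLIntegral_const]
  -- With the constant side in polar form too, the circle inequality can be integrated radius by
  -- radius.
  rw [hVeq, hconst, setLIntegral_ball_eq_polar hV, setLIntegral_ball_eq_polar measurable_const]
  refine setLIntegral_mono' measurableSet_Ioo fun r hr ↦ ?_
  gcongr 1
  rw [setLIntegral_const]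
  have hsub : closedBall c r ⊆ ball c ρ := closedBall_subset_ball hr.2
  refine (ofReal_log_norm_mul_le_lintegral_angle hr.1
    ((hf.analyticOnNhd isOpen_ball).mono hsub)).trans_eq (lintegral_congr fun θ ↦ ?_)
  rw [hVdef, indicator_of_mem (hsub (circleMap_mem_closedBall c hr.1.le θ))]

end Submean

/-! ### Hartogs' lemma on sequences of holomorphic functions. -/

section HartogsLemma

open Metric Set Filter Topology MeasureTheory
open scoped Real ENNReal

/-- **Hartogs' lemma**: if a family of sequences of holomorphic functions on a disc grows at most
geometrically, and at each point is bounded uniformly over the family, then it grows on a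
smaller disc, uniformly, at most like any geometric sequence of ratio greater than one. -/
theorem exists_forall_norm_le_mul_pow_of_pointwise_bounded {ι : Type*} {f : ℕ → ι → ℂ → ℂ} {w₀ : ℂ}
    {ρ M A t : ℝ} (hρ : 0 < ρ) (hA : 1 ≤ A) (ht : 1 < t)
    (hf : ∀ k i, DifferentiableOn ℂ (f k i) (ball w₀ (2 * ρ)))
    (hM : ∀ k i, ∀ w ∈ ball w₀ (2 * ρ), ‖f k i w‖ ≤ M * A ^ k)
    (hC : ∀ w ∈ ball w₀ (2 * ρ), ∃ C, ∀ k i, ‖f k i w‖ ≤ C) :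
    ∃ C, ∀ w ∈ ball w₀ ρ, ∀ k i, ‖f k i w‖ ≤ C * t ^ k := by
  set B := ball w₀ (2 * ρ) with hB
  set v : ℕ → ι → ℂ → ℝ := fun k i w ↦ Real.posLog ‖f k i w‖ / k with hv
  set V : ℕ → ℂ → ℝ≥0∞ := fun k w ↦ ⨆ i, B.indicator (fun w ↦ ENNReal.ofReal (v k i w)) w with hV
  -- The index set may be uncountable, so measurability of the supremum comes from lower
  -- semicontinuity.
  have hmeas (k : ℕ) : Measurable (V k) := by
    refine LowerSemicontinuous.measurable (lowerSemicontinuous_iSup fun i ↦ ?_)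
    rw [lowerSemicontinuous_iff_isOpen_preimage]
    intro y
    have hcont : ContinuousOn (fun w ↦ ENNReal.ofReal (v k i w)) B :=
      ENNReal.continuous_ofReal.comp_continuousOn
        ((Real.continuous_posLog.comp_continuousOn (hf k i).continuousOn.norm).div_const _)
    convert hcont.isOpen_inter_preimage isOpen_ball (isOpen_Ioi (a := y)) using 1
    ext w
    by_cases hw : w ∈ B
    · simp [hw]
    · simp [hw]
  set b := Real.posLog M + Real.log A with hb
  have hlogA : 0 ≤ Real.log A := Real.log_nonneg hA
  have hvle {k : ℕ} (hk : 1 ≤ k) (i : ι) {w : ℂ} (hw : w ∈ B) : v k i w ≤ b := by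
    have hk' : (1 : ℝ) ≤ k := mod_cast hk
    have h1 : Real.posLog ‖f k i w‖ ≤ Real.posLog M + k * Real.log A := by
      refine (Real.posLog_le_posLog (norm_nonneg _) (hM k i w hw)).trans ?_
      refine Real.posLog_mul.trans (add_le_add_right ?_ _)
      rw [Real.posLog_eq_log (by rw [abs_of_nonneg (by positivity)]; exact one_le_pow₀ hA),
        Real.log_pow]
    rw [hv]
    simp only
    rw [div_le_iff₀ (by positivity)]
    have := Real.posLog_nonneg (x := M)
    nlinarith
  -- Dominated convergence: `V k` is at most `b` on the disc, and at each point at most `log⁺ C /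
  -- k`. The shift to `k + 1` avoids division by zero.
  have hlim : Tendsto (fun k ↦ ∫⁻ w in B, V (k + 1) w) atTop (𝓝 0) := by
    have h0 : (0 : ℝ≥0∞) = ∫⁻ w in B, (fun _ ↦ 0) w := by simp
    rw [h0]
    refine tendsto_lintegral_of_dominated_convergence (fun _ ↦ ENNReal.ofReal b)
      (fun k ↦ hmeas _) (fun k ↦ ?_) ?_ ?_
    · filter_upwards [ae_restrict_mem measurableSet_ball] with w hw
      refine iSup_le fun i ↦ ?_
      rw [indicator_of_mem hw]
      exact ENNReal.ofReal_le_ofReal (hvle (by omega) i hw)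
    · rw [setLIntegral_const]
      exact ENNReal.mul_ne_top ENNReal.ofReal_ne_top measure_ball_lt_top.ne
    · filter_upwards [ae_restrict_mem measurableSet_ball] with w hw
      obtain ⟨C, hC⟩ := hC w hw
      have hlimC : Tendsto (fun k : ℕ ↦ ENNReal.ofReal (Real.posLog C / ((k : ℝ) + 1))) atTop
          (𝓝 0) := by
        rw [← ENNReal.ofReal_zero]
        refine ENNReal.tendsto_ofReal ?_
        exact tendsto_const_nhds.div_atTop
          (tendsto_atTop_add_const_right _ _ tendsto_natCast_atTop_atTop)
      refine tendsto_of_tendsto_of_tendsto_of_le_of_le tendsto_const_nhds hlimC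
        (fun _ ↦ zero_le) fun k ↦ iSup_le fun i ↦ ?_
      rw [indicator_of_mem hw]
      apply ENNReal.ofReal_le_ofReal
      simp only [hv]
      push_cast
      gcongr
      exact hC _ i
  have hlogt : 0 < Real.log t := Real.log_pos ht
  have hvol : 0 < volume (ball w₀ ρ) := measure_ball_pos _ _ hρ
  have hε : 0 < ENNReal.ofReal (Real.log t) * volume (ball w₀ ρ) :=
    ENNReal.mul_pos (by simpa using hlogt) hvol.ne'
  obtain ⟨K, hK⟩ := eventually_atTop.1 (hlim.eventually_lt_const hε)
  -- Discs of radius `ρ` about points of `ball w₀ ρ` stay in `B` and share one volume, so the choice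
  -- of `K` is uniform in `w` and `i`.
  have hlarge : ∀ w ∈ ball w₀ ρ, ∀ k, K + 1 ≤ k → ∀ i, ‖f k i w‖ ≤ t ^ k := by
    intro w hw k hk i
    have hk0 : (0 : ℝ) < k := by
      have : 0 < k := by omega
      exact_mod_cast this
    have hsub : ball w ρ ⊆ B := ball_subset_ball' (by have := mem_ball.1 hw; linarith)
    have h1 := ofReal_log_norm_mul_volume_ball_le ((hf k i).mono hsub)
    have h2 : ∫⁻ z in ball w ρ, ENNReal.ofReal (Real.posLog ‖f k i z‖) ≤
        ENNReal.ofReal k * ∫⁻ z in B, V k z := by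
      calc ∫⁻ z in ball w ρ, ENNReal.ofReal (Real.posLog ‖f k i z‖)
          ≤ ∫⁻ z in B, ENNReal.ofReal (Real.posLog ‖f k i z‖) :=
            lintegral_mono_set hsub
        _ ≤ ∫⁻ z in B, ENNReal.ofReal k * V k z := by
            refine setLIntegral_mono' measurableSet_ball fun z hz ↦ ?_
            have h3 : ENNReal.ofReal (v k i z) ≤ V k z := by
              refine le_trans (le_of_eq ?_) (le_iSup _ i)
              rw [indicator_of_mem hz]
            refine le_trans (le_of_eq ?_) (mul_le_mul_right h3 _)
            rw [← ENNReal.ofReal_mul hk0.le]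
            congr 1
            simp only [hv]
            field_simp
        _ = _ := lintegral_const_mul _ (hmeas k)
    have h3 := hK (k - 1) (by omega)
    rw [show k - 1 + 1 = k by omega] at h3
    have hvoleq : volume (ball w ρ) = volume (ball w₀ ρ) := by
      rw [Measure.addHaar_ball_center volume w, Measure.addHaar_ball_center volume w₀]
    have h4 : ENNReal.ofReal (Real.log ‖f k i w‖) * volume (ball w₀ ρ) ≤
        ENNReal.ofReal (k * Real.log t) * volume (ball w₀ ρ) := by
      rw [← hvoleq, ENNReal.ofReal_mul hk0.le, mul_assoc, hvoleq]
      rw [hvoleq] at h1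
      exact h1.trans (h2.trans (mul_le_mul_right h3.le _))
    have h5 := (ENNReal.mul_le_mul_iff_left hvol.ne' measure_ball_lt_top.ne).1 h4
    rw [ENNReal.ofReal_le_ofReal_iff (by positivity)] at h5
    rcases eq_or_ne (f k i w) 0 with h0 | h0
    · rw [h0, norm_zero]
      positivity
    · rwa [← Real.log_pow, Real.log_le_log_iff (by positivity) (by positivity)] at h5
  -- The second entry absorbs the finitely many indices `k ≤ K`, by the crude geometric bound.
  refine ⟨max 1 (|M| * A ^ K), fun w hw k i ↦ ?_⟩
  have htk : 1 ≤ t ^ k := one_le_pow₀ ht.le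
  by_cases hk : K + 1 ≤ k
  · refine (hlarge w hw k hk i).trans ?_
    exact le_mul_of_one_le_left (by positivity) (le_max_left _ _)
  · calc ‖f k i w‖ ≤ M * A ^ k := hM k i w (ball_subset_ball (by linarith) hw)
      _ ≤ |M| * A ^ K := by
        gcongr
        · exact le_abs_self M
        · omega
      _ ≤ max 1 (|M| * A ^ K) := le_max_right _ _
      _ ≤ _ := le_mul_of_one_le_right (by positivity) htk

end HartogsLemma

/-! ### Hartogs' theorem for scalar functions. -/

section Hartogs

open Metric Set Filter Topology

/-- If `u` is continuous in each variable, then it is bounded on the product of some small ball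
and a given compact set. -/
theorem exists_ball_forall_norm_le_of_separately_continuousOn {X Y G : Type*} [PseudoMetricSpace X]
    [CompleteSpace X] [TopologicalSpace Y] [SeminormedAddCommGroup G] {u : X × Y → G} {z₀ : X}
    {R : ℝ} {K : Set Y} (hR : 0 < R) (hK : IsCompact K)
    (h₁ : ∀ w ∈ K, ContinuousOn (fun z ↦ u (z, w)) (closedBall z₀ R))
    (h₂ : ∀ z ∈ closedBall z₀ R, ContinuousOn (fun w ↦ u (z, w)) K) :
    ∃ z₁ ∈ ball z₀ R, ∃ r > 0, ball z₁ r ⊆ ball z₀ R ∧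
      ∃ M, ∀ z ∈ ball z₁ r, ∀ w ∈ K, ‖u (z, w)‖ ≤ M := by
  -- Adding the complement of the ball makes these closed sets cover all of `X`, so Baire's theorem
  -- applies in `X` itself.
  set S : ℕ → Set X := fun m ↦
    (ball z₀ R)ᶜ ∪ ({z ∈ closedBall z₀ R | ∀ w ∈ K, ‖u (z, w)‖ ≤ m}) with hS
  have hclosed (m : ℕ) : IsClosed (S m) := by
    refine isOpen_ball.isClosed_compl.union ?_
    have : {z ∈ closedBall z₀ R | ∀ w ∈ K, ‖u (z, w)‖ ≤ m} =
        closedBall z₀ R ∩ ⋂ w ∈ K, closedBall z₀ R ∩ (fun z ↦ ‖u (z, w)‖) ⁻¹' Iic (m : ℝ) := by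
      ext z
      simp only [mem_ofPred_eq, mem_inter_iff, mem_iInter, mem_preimage, mem_Iic]
      exact ⟨fun h ↦ ⟨h.1, fun w hw ↦ ⟨h.1, h.2 w hw⟩⟩, fun h ↦ ⟨h.1, fun w hw ↦ (h.2 w hw).2⟩⟩
    rw [this]
    exact isClosed_closedBall.inter (isClosed_biInter fun w hw ↦
      (h₁ w hw).norm.preimage_isClosed_of_isClosed isClosed_closedBall isClosed_Iic)
  have hcover : ⋃ m, S m = univ := by
    refine eq_univ_of_forall fun z ↦ mem_iUnion.2 ?_
    by_cases hz : z ∈ ball z₀ R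
    · obtain ⟨C, hC⟩ := hK.exists_bound_of_continuousOn (h₂ z (ball_subset_closedBall hz))
      obtain ⟨m, hm⟩ := exists_nat_ge C
      exact ⟨m, Or.inr ⟨ball_subset_closedBall hz, fun w hw ↦ (hC w hw).trans hm⟩⟩
    · exact ⟨0, Or.inl hz⟩
  obtain ⟨z₁, hz₁, hmem⟩ := (dense_iUnion_interior_of_closed hclosed hcover).inter_open_nonempty
    (ball z₀ R) isOpen_ball ⟨z₀, mem_ball_self hR⟩
  obtain ⟨m, hm⟩ := mem_iUnion.1 hmem
  obtain ⟨r, hr, hsub⟩ := Metric.isOpen_iff.1 (isOpen_ball.inter isOpen_interior) z₁ ⟨hz₁, hm⟩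
  refine ⟨z₁, hz₁, r, hr, fun z hz ↦ (hsub hz).1, m, fun z hz w hw ↦ ?_⟩
  rcases interior_subset (hsub hz).2 with h | h
  · exact absurd (hsub hz).1 h
  · exact h.2 w hw

variable {E : Type*} [NormedAddCommGroup E] [NormedSpace ℂ E]

/-- A function that is separately holomorphic on a polydisc and bounded on a thinner polydisc is
bounded on a polydisc with the same width as the former. -/
theorem exists_forall_norm_le_of_separately_of_bounded {u : E × ℂ → ℂ} {z₁ : E} {w₀ : ℂ}
    {R r ρ M : ℝ} (hR : 0 < R) (hr : 0 < r) (hρ : 0 < ρ)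
    (h₁ : ∀ w ∈ ball w₀ (2 * ρ), ∀ z ∈ closedBall z₁ R, DifferentiableAt ℂ (fun z ↦ u (z, w)) z)
    (hC : ∀ w ∈ ball w₀ (2 * ρ), ∃ C, ∀ z ∈ closedBall z₁ R, ‖u (z, w)‖ ≤ C)
    (hu : DifferentiableOn ℂ u (ball z₁ r ×ˢ ball w₀ (2 * ρ)))
    (hM : ∀ z ∈ ball z₁ r, ∀ w ∈ ball w₀ (2 * ρ), ‖u (z, w)‖ ≤ M) :
    ∃ C, ∀ z ∈ closedBall z₁ (2 / 3 * R), ∀ w ∈ ball w₀ ρ, ‖u (z, w)‖ ≤ C := by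
  -- Taylor coefficients along the line in direction `e`. Indexing the family by all directions
  -- replaces a multivariable power series.
  set f : ℕ → closedBall (0 : E) R → ℂ → ℂ := fun k e w ↦
    (k.factorial : ℂ)⁻¹ * iteratedDeriv k (fun l : ℂ ↦ u (z₁ + l • (e : E), w)) 0 with hf
  have hM0 : 0 ≤ M :=
    (norm_nonneg _).trans (hM z₁ (mem_ball_self hr) w₀ (mem_ball_self (by positivity)))
  have hline (e : closedBall (0 : E) R) (l : ℂ) (hl : ‖l‖ ≤ 1) :
      z₁ + l • (e : E) ∈ closedBall z₁ R := by
    have he : ‖(e : E)‖ ≤ R := mem_closedBall_zero_iff.1 e.2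
    simp only [mem_closedBall, dist_self_add_left, norm_smul]
    nlinarith [norm_nonneg l, norm_nonneg (e : E)]
  have hline' (e : closedBall (0 : E) R) (l : ℂ) (hl : ‖l‖ < r / R) :
      z₁ + l • (e : E) ∈ ball z₁ r := by
    have he : ‖(e : E)‖ ≤ R := mem_closedBall_zero_iff.1 e.2
    simp only [mem_ball, dist_self_add_left, norm_smul]
    calc ‖l‖ * ‖(e : E)‖ ≤ ‖l‖ * R := by gcongr
      _ < r / R * R := by gcongr
      _ = r := by field_simp
  have hdiff (e : closedBall (0 : E) R) (w : ℂ) (hw : w ∈ ball w₀ (2 * ρ)) :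
      DifferentiableOn ℂ (fun l : ℂ ↦ u (z₁ + l • (e : E), w)) (closedBall 0 1) := by
    intro l hl
    refine DifferentiableAt.differentiableWithinAt ?_
    exact (h₁ w hw _ (hline e l (by simpa using hl))).comp (f := fun l : ℂ ↦ z₁ + l • (e : E)) l
      (by fun_prop)
  have hcoef (e : closedBall (0 : E) R) (w : ℂ) (k : ℕ) {q C : ℝ} (hq : 0 < q)
      (hd : DifferentiableOn ℂ (fun l : ℂ ↦ u (z₁ + l • (e : E), w)) (closedBall 0 q))
      (hb : ∀ l ∈ sphere (0 : ℂ) q, ‖u (z₁ + l • (e : E), w)‖ ≤ C) : ‖f k e w‖ ≤ C / q ^ k := by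
    have := Complex.norm_iteratedDeriv_le_of_forall_mem_sphere_norm_le k hq
      (hd.mono closure_ball_subset_closedBall).diffContOnCl hb
    rw [hf]
    simp only [norm_mul, norm_inv, Complex.norm_natCast]
    rw [inv_mul_le_iff₀ (by positivity)]
    exact this.trans_eq (by ring)
  -- For `‖l‖ ≤ q` the point `z₁ + l • e` stays in the thin ball, so the `k`-th coefficient is at
  -- most `M / q ^ k`. The unit circle gives the bound independent of `k` and `e` at each fixed `w`.
  set q := r / R / 2 with hq
  have hq0 : 0 < q := by positivity
  have hqlt : q < r / R := by rw [hq]; linarith [show 0 < r / R by positivity]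
  have hG (e : closedBall (0 : E) R) : DifferentiableOn ℂ
      (fun p : ℂ × ℂ ↦ u (z₁ + p.1 • (e : E), p.2)) (ball 0 (r / R) ×ˢ ball w₀ (2 * ρ)) :=
    hu.comp (by fun_prop) fun p hp ↦ ⟨hline' e p.1 (by simpa using hp.1), hp.2⟩
  obtain ⟨C, hCt⟩ := exists_forall_norm_le_mul_pow_of_pointwise_bounded (f := f) (w₀ := w₀)
    (ρ := ρ) (M := M) (A := max 1 q⁻¹) (t := 4 / 3) hρ (le_max_left _ _) (by norm_num)
    (fun k e ↦ (differentiableOn_iteratedDeriv_fst (by positivity) (hG e)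
      (fun p hp ↦ hM _ (hline' e p.1 (by simpa using hp.1)) _ hp.2) k).const_mul _)
    (fun k e w hw ↦ by
      refine (hcoef e w k hq0 ((hG e).comp (f := fun l : ℂ ↦ (l, w)) (by fun_prop)
        fun l hl ↦ ⟨closedBall_subset_ball hqlt hl, hw⟩)
        fun l hl ↦ hM _ (hline' e l ?_) w hw).trans ?_
      · rwa [mem_sphere_zero_iff_norm.1 hl]
      · rw [div_eq_mul_inv, ← inv_pow]
        gcongr
        exact le_max_right _ _)
    (fun w hw ↦ by
      obtain ⟨C, hC⟩ := hC w hw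
      refine ⟨C, fun k e ↦ ?_⟩
      simpa using hcoef e w k one_pos (hdiff e w hw)
        fun l hl ↦ hC _ (hline e l (mem_sphere_zero_iff_norm.1 hl).le))
  -- A point within `2 / 3 * R` of `z₁` is reached at parameter `2 / 3`. With coefficients at most
  -- `C * (4 / 3) ^ k`, the series has ratio `8 / 9` and sum at most `9 * C`.
  refine ⟨C * 9, fun z hz w hw ↦ ?_⟩
  have hw' : w ∈ ball w₀ (2 * ρ) := ball_subset_ball (by linarith) hw
  have he : (3 / 2 : ℂ) • (z - z₁) ∈ closedBall (0 : E) R := by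
    rw [mem_closedBall, dist_eq_norm] at hz
    rw [mem_closedBall_zero_iff, norm_smul]
    norm_num
    linarith
  set e : closedBall (0 : E) R := ⟨(3 / 2 : ℂ) • (z - z₁), he⟩ with hedef
  have hsum := Complex.hasSum_taylorSeries_on_ball
    ((hdiff e w hw').mono ball_subset_closedBall) (z := 2 / 3) (by simp; norm_num)
  have hz' : z₁ + (2 / 3 : ℂ) • (e : E) = z := by
    rw [hedef, smul_smul]
    norm_num
  rw [hz'] at hsum
  rw [← hsum.tsum_eq]
  have hgeo := (hasSum_geometric_of_lt_one (r := 8 / 9) (by norm_num) (by norm_num)).mul_left C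
  norm_num at hgeo
  refine tsum_of_norm_bounded hgeo fun k ↦ ?_
  have hk := hCt w hw k e
  calc ‖(k.factorial : ℂ)⁻¹ • (2 / 3 - 0 : ℂ) ^ k •
        iteratedDeriv k (fun l : ℂ ↦ u (z₁ + l • (e : E), w)) 0‖
      = (2 / 3) ^ k * ‖f k e w‖ := by
        simp only [hf, smul_eq_mul, norm_mul, sub_zero, norm_pow]
        norm_num
        ring
    _ ≤ (2 / 3) ^ k * (C * (4 / 3) ^ k) := by gcongr
    _ = C * (8 / 9) ^ k := by
        rw [mul_left_comm, ← mul_pow]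
        norm_num

/-- **Hartogs' theorem** for a product of a finite-dimensional space and the complex plane. -/
theorem differentiableAt_prod_of_separately [ProperSpace E] {D : Set (E × ℂ)} (hD : IsOpen D)
    {u : E × ℂ → ℂ} (h₁ : ∀ p ∈ D, DifferentiableAt ℂ (fun z ↦ u (z, p.2)) p.1)
    (h₂ : ∀ p ∈ D, DifferentiableAt ℂ (fun w ↦ u (p.1, w)) p.2) {p : E × ℂ} (hp : p ∈ D) :
    DifferentiableAt ℂ u p := by
  obtain ⟨z₀, w₀⟩ := p
  obtain ⟨δ, hδ, hball⟩ := Metric.isOpen_iff.1 hD _ hp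
  rw [← ball_prod_same] at hball
  -- Closed balls of radius `4 * R` then lie inside the `δ`-balls.
  set R := δ / 5 with hRdef
  have hR : 0 < R := by positivity
  have hsub : closedBall z₀ (4 * R) ×ˢ closedBall w₀ (4 * R) ⊆ D :=
    (Set.prod_mono (closedBall_subset_ball (by linarith))
      (closedBall_subset_ball (by linarith))).trans hball
  have hd₁ (z : E) (hz : z ∈ closedBall z₀ (4 * R)) (w : ℂ) (hw : w ∈ closedBall w₀ (4 * R)) :
      DifferentiableAt ℂ (fun z ↦ u (z, w)) z := h₁ (z, w) (hsub ⟨hz, hw⟩)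
  have hd₂ (z : E) (hz : z ∈ closedBall z₀ (4 * R)) (w : ℂ) (hw : w ∈ closedBall w₀ (4 * R)) :
      DifferentiableAt ℂ (fun w ↦ u (z, w)) w := h₂ (z, w) (hsub ⟨hz, hw⟩)
  have hR4 : closedBall z₀ R ⊆ closedBall z₀ (4 * R) := closedBall_subset_closedBall (by linarith)
  obtain ⟨z₁, hz₁, r, hr, hrsub, M, hM⟩ :=
    exists_ball_forall_norm_le_of_separately_continuousOn (u := u) hR
      (isCompact_closedBall w₀ (4 * R))
      (fun w hw z hz ↦ (hd₁ z (hR4 hz) w hw).continuousAt.continuousWithinAt)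
      (fun z hz w hw ↦ (hd₂ z (hR4 hz) w hw).continuousAt.continuousWithinAt)
  have hz₁' := mem_ball.1 hz₁
  have hthin : ∀ z ∈ ball z₁ r, z ∈ closedBall z₀ (4 * R) := fun z hz ↦
    hR4 (ball_subset_closedBall (hrsub hz))
  have hmid : closedBall z₁ (3 * R) ⊆ closedBall z₀ (4 * R) :=
    closedBall_subset_closedBall' (by linarith)
  have hwid : ball w₀ (2 * (2 * R)) ⊆ closedBall w₀ (4 * R) := by
    rw [show 2 * (2 * R) = 4 * R by ring]
    exact ball_subset_closedBall
  have hthinDiff : DifferentiableOn ℂ u (ball z₁ r ×ˢ ball w₀ (2 * (2 * R))) := by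
    intro p hp
    refine DifferentiableAt.differentiableWithinAt ?_
    obtain ⟨ε, hε, hεsub⟩ := Metric.isOpen_iff.1 (isOpen_ball.prod isOpen_ball) p hp
    rw [← Prod.mk.eta (p := p), ← ball_prod_same] at hεsub
    have hmem {z : E} {w : ℂ} (hz : z ∈ ball p.1 ε) (hw : w ∈ ball p.2 ε) :=
      hεsub (show (z, w) ∈ ball p.1 ε ×ˢ ball p.2 ε from ⟨hz, hw⟩)
    refine differentiableAt_of_separately_of_bounded hε (M := M)
      (fun w hw z hz ↦ ?_) (fun z hz w hw ↦ ?_) fun z hz w hw ↦ ?_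
    · exact (hd₁ z (hthin z (hmem hz hw).1) w (hwid (hmem hz hw).2)).differentiableWithinAt
    · exact (hd₂ z (hthin z (hmem hz hw).1) w (hwid (hmem hz hw).2)).differentiableWithinAt
    · exact hM z (hmem hz hw).1 w (hwid (hmem hz hw).2)
  -- Baire's centre `z₁` need not be `z₀`, but it lies within `R` of it. The radius `3 * R` about
  -- `z₁` stays in the domain, and two thirds of it, `2 * R`, still covers `ball z₀ R`.
  obtain ⟨C, hC⟩ := exists_forall_norm_le_of_separately_of_bounded (R := 3 * R) (ρ := 2 * R)
    (by positivity) hr (by positivity)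
    (fun w hw z hz ↦ hd₁ z (hmid hz) w (hwid hw))
    (fun w hw ↦ (isCompact_closedBall z₁ (3 * R)).exists_bound_of_continuousOn fun z hz ↦
      (hd₁ z (hmid hz) w (hwid hw)).continuousAt.continuousWithinAt)
    hthinDiff (fun z hz w hw ↦ hM z hz w (hwid hw))
  have hz₀ : ball z₀ R ⊆ closedBall z₁ (2 / 3 * (3 * R)) := by
    refine ball_subset_closedBall.trans (closedBall_subset_closedBall' ?_)
    rw [dist_comm]
    linarith
  have hw₀ : ball w₀ R ⊆ closedBall w₀ (4 * R) :=
    ball_subset_closedBall.trans (closedBall_subset_closedBall (by linarith))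
  exact differentiableAt_of_separately_of_bounded (c := (z₀, w₀)) hR (M := C)
    (fun w hw z hz ↦ (hd₁ z (hR4 (ball_subset_closedBall hz)) w (hw₀ hw)).differentiableWithinAt)
    (fun z hz w hw ↦ (hd₂ z (hR4 (ball_subset_closedBall hz)) w (hw₀ hw)).differentiableWithinAt)
    (fun z hz w hw ↦ hC z (hz₀ hz) w (ball_subset_ball (by linarith) hw))

/-- **Hartogs' theorem**: a separately holomorphic function on an open subset of `ℂⁿ` is
holomorphic. -/
theorem differentiableAt_pi_of_separately {n : ℕ} {D : Set (Fin n → ℂ)} (hD : IsOpen D)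
    {u : (Fin n → ℂ) → ℂ}
    (h : ∀ a ∈ D, ∀ j, DifferentiableAt ℂ (fun t ↦ u (Function.update a j t)) (a j))
    {a : Fin n → ℂ} (ha : a ∈ D) : DifferentiableAt ℂ u a := by
  induction n with
  | zero => exact (hasFDerivAt_of_subsingleton u a).differentiableAt
  | succ n ih =>
    set c : (Fin n → ℂ) × ℂ → Fin (n + 1) → ℂ := fun p ↦ Fin.cons p.2 p.1 with hc
    have hcc : Continuous c := by
      refine continuous_pi fun i ↦ ?_
      refine Fin.cases ?_ (fun i ↦ ?_) i
      · simp only [hc, Fin.cons_zero]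
        fun_prop
      · simp only [hc, Fin.cons_succ]
        fun_prop
    have hprod : DifferentiableAt ℂ (u ∘ c) (Fin.tail a, a 0) := by
      refine differentiableAt_prod_of_separately (hD.preimage hcc) (fun p hp ↦ ?_)
        (fun p hp ↦ ?_) (show c (Fin.tail a, a 0) ∈ D by simpa [hc] using ha)
      -- Freezing the first coordinate leaves a separately holomorphic function on an open slice, to
      -- which the induction hypothesis applies.
      · refine ih (D := {z | c (z, p.2) ∈ D}) (hD.preimage (hcc.comp (by fun_prop)))
          (fun z hz j ↦ ?_) hp
        have := h _ hz j.succ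
        simpa [hc, Fin.cons_update] using this
      · simpa [hc, Fin.update_cons_zero] using h _ hp 0
    have heq : u = (u ∘ c) ∘ fun x : Fin (n + 1) → ℂ ↦ (Fin.tail x, x 0) := by
      ext x
      simp [hc]
    rw [heq]
    refine DifferentiableAt.comp a hprod ?_
    unfold Fin.tail
    fun_prop

end Hartogs

/-! ### Passage from scalar functions to values in `𝕆_ℂ`. -/

noncomputable section

namespace SliceOctonion

instance : FiniteDimensional ℝ Octonion :=
  inferInstanceAs (FiniteDimensional ℝ (WithLp 2 (Quaternion ℝ × Quaternion ℝ)))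

instance : FiniteDimensional ℝ OctonionC :=
  inferInstanceAs (FiniteDimensional ℝ (WithLp 2 (Octonion × Octonion)))

/-- The complex coordinate `x + i y ↦ ℓ x + i ℓ y` on `𝕆_ℂ` induced by a real linear form `ℓ`
on `𝕆`. -/
def complexCoord (l : Octonion →ₗ[ℝ] ℝ) : OctonionC →L[ℝ] ℂ :=
  LinearMap.toContinuousLinearMap
    { toFun := fun w ↦ ⟨l w.re, l w.im⟩
      map_add' := fun v w ↦ Complex.ext (map_add l v.re w.re) (map_add l v.im w.im)
      map_smul' := fun r w ↦ by
        apply Complex.ext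
        · exact (map_smul l r w.re).trans (Complex.smul_re r ⟨l w.re, l w.im⟩).symm
        · exact (map_smul l r w.im).trans (Complex.smul_im r ⟨l w.re, l w.im⟩).symm }

theorem complexCoord_apply (l : Octonion →ₗ[ℝ] ℝ) (w : OctonionC) :
    complexCoord l w = ⟨l w.re, l w.im⟩ := rfl

/-- Coordinates are complex linear for the structure `mulI`, so `dbar F = 0` becomes the scalar
Cauchy-Riemann equation. -/
theorem complexCoord_mulI (l : Octonion →ₗ[ℝ] ℝ) (w : OctonionC) :
    complexCoord l w.mulI = Complex.I * complexCoord l w := by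
  rw [complexCoord_apply, complexCoord_apply]
  apply Complex.ext
  · simp only [Complex.I_mul_re]
    exact map_neg l w.im
  · simp only [Complex.I_mul_im]
    rfl

/-- The inclusion of `𝕆` as the real part of `𝕆_ℂ`. -/
def inclRe : Octonion →ₗ[ℝ] OctonionC where
  toFun x := OctonionC.mk x 0
  map_add' x y := by
    change OctonionC.mk (x + y) 0 = OctonionC.mk (x + y) (0 + 0)
    rw [add_zero]
  map_smul' r x := by
    change OctonionC.mk (r • x) 0 = OctonionC.mk (r • x) (r • 0)
    rw [smul_zero]

/-- The inclusion of `𝕆` as the imaginary part of `𝕆_ℂ`. -/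
def inclIm : Octonion →ₗ[ℝ] OctonionC where
  toFun x := OctonionC.mk 0 x
  map_add' x y := by
    change OctonionC.mk 0 (x + y) = OctonionC.mk (0 + 0) (x + y)
    rw [add_zero]
  map_smul' r x := by
    change OctonionC.mk 0 (r • x) = OctonionC.mk (r • 0) (r • x)
    rw [smul_zero]

theorem inclRe_add_inclIm (w : OctonionC) : inclRe w.re + inclIm w.im = w := by
  change OctonionC.mk (w.re + 0) (0 + w.im) = w
  rw [add_zero, zero_add]
  rfl

/-- An element of `𝕆_ℂ` is determined by its complex coordinates. -/
theorem sum_complexCoord_smul {ι : Type*} [Fintype ι] (b : Module.Basis ι ℝ Octonion)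
    (w : OctonionC) :
    ∑ k, ((complexCoord (b.coord k) w).re • inclRe (b k) +
      (complexCoord (b.coord k) w).im • inclIm (b k)) = w := by
  have h₁ : ∑ k, (complexCoord (b.coord k) w).re • inclRe (b k) = inclRe w.re := by
    conv_rhs => rw [← b.sum_repr w.re, map_sum]
    simp only [complexCoord_apply, map_smul, Module.Basis.coord_apply]
  have h₂ : ∑ k, (complexCoord (b.coord k) w).im • inclIm (b k) = inclIm w.im := by
    conv_rhs => rw [← b.sum_repr w.im, map_sum]
    simp only [complexCoord_apply, map_smul, Module.Basis.coord_apply]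
  rw [Finset.sum_add_distrib, h₁, h₂, inclRe_add_inclIm]

variable {n : ℕ}

theorem isOpen_sliceSet {D : Set (Fin n → ℂ)} (hD : IsOpen D) (j : Fin n) (a : Fin n → ℂ) :
    IsOpen (sliceSet D j a) :=
  hD.preimage (continuous_const.update j (continuous_apply 0))

theorem dbar_eq_zero_iff {m : ℕ} {F : (Fin m → ℂ) → OctonionC} {t : Fin m} {z : Fin m → ℂ} :
    dbar F t z = 0 ↔ fderiv ℝ F z (Pi.single t 1) =
      -(fderiv ℝ F z (Pi.single t Complex.I)).mulI := by
  rw [dbar, smul_eq_zero, or_iff_right (by norm_num), add_eq_zero_iff_eq_neg]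

/-- The complex coordinates of a holomorphic function of one variable are holomorphic. -/
theorem IsHolomorphic.differentiableAt_complexCoord {U : Set (Fin 1 → ℂ)}
    {G : (Fin 1 → ℂ) → OctonionC} (hU : IsOpen U) (hG : IsHolomorphic U G)
    (l : Octonion →ₗ[ℝ] ℝ) {u : ℂ} (hu : (fun _ ↦ u) ∈ U) :
    DifferentiableAt ℂ (fun t ↦ complexCoord l (G fun _ ↦ t)) u := by
  have hGd : DifferentiableAt ℝ G fun _ ↦ u :=
    (hG.1.differentiableOn (by norm_num)).differentiableAt (hU.mem_nhds hu)
  have hconst : HasFDerivAt (fun (t : ℂ) (_ : Fin 1) ↦ t)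
      (ContinuousLinearMap.pi fun _ ↦ ContinuousLinearMap.id ℝ ℂ) u :=
    hasFDerivAt_pi.2 fun _ ↦ hasFDerivAt_id u
  have hcomp := (complexCoord l).hasFDerivAt.comp u (hGd.hasFDerivAt.comp u hconst)
  have hsingle (s : ℂ) : (fun _ ↦ s : Fin 1 → ℂ) = Pi.single 0 s := by
    ext i
    rw [Subsingleton.elim i 0, Pi.single_eq_same]
  rw [differentiableAt_complex_iff_differentiableAt_real]
  refine ⟨hcomp.differentiableAt, ?_⟩
  have hval (s : ℂ) : fderiv ℝ (fun t ↦ complexCoord l (G fun _ ↦ t)) u s =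
      complexCoord l (fderiv ℝ G (fun _ ↦ u) (Pi.single 0 s)) := by
    rw [← hsingle, show fderiv ℝ (fun t ↦ complexCoord l (G fun _ ↦ t)) u = _ from hcomp.fderiv]
    rfl
  -- The vanishing of `dbar` says that the derivative along `1` is `-i` times the one along `i`;
  -- multiplying by `i` gives the Cauchy-Riemann equation.
  rw [hval, hval, dbar_eq_zero_iff.1 (hG.2 _ hu 0), map_neg, complexCoord_mulI, smul_eq_mul,
    mul_neg, ← mul_assoc, Complex.I_mul_I]
  ring

/-- A function into `𝕆_ℂ` is of class `C¹` if its complex coordinates are complex differentiable. -/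
theorem contDiffOn_of_differentiableOn_complexCoord {E : Type*} [NormedAddCommGroup E]
    [NormedSpace ℂ E] {D : Set E} (hD : IsOpen D) {F : E → OctonionC}
    (h : ∀ l : Octonion →ₗ[ℝ] ℝ, DifferentiableOn ℂ (fun z ↦ complexCoord l (F z)) D) :
    ContDiffOn ℝ 1 F D := by
  have hC (l : Octonion →ₗ[ℝ] ℝ) : ContDiffOn ℝ 1 (fun z ↦ complexCoord l (F z)) D := by
    refine ContDiffOn.restrict_scalars ℝ (𝕜' := ℂ) ?_
    rw [← zero_add (1 : WithTop ℕ∞), contDiffOn_succ_iff_fderiv_of_isOpen hD]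
    exact ⟨h l, by simp, contDiffOn_zero.2 ((h l).continuousOn_fderiv_complex hD)⟩
  set b := Module.finBasis ℝ Octonion
  have hF : F = fun z ↦ ∑ k, ((complexCoord (b.coord k) (F z)).re • inclRe (b k) +
      (complexCoord (b.coord k) (F z)).im • inclIm (b k)) :=
    funext fun z ↦ (sum_complexCoord_smul b (F z)).symm
  rw [hF]
  exact ContDiffOn.sum fun k _ ↦
    ((Complex.reCLM.contDiff.comp_contDiffOn (hC (b.coord k))).smul contDiffOn_const).add
      ((Complex.imCLM.contDiff.comp_contDiffOn (hC (b.coord k))).smul contDiffOn_const)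

/-- The derivative `∂/∂z̄_j` is computed along the slice. -/
theorem dbar_sliceFun {F : (Fin n → ℂ) → OctonionC} {a : Fin n → ℂ} (hF : DifferentiableAt ℝ F a)
    (j : Fin n) : dbar (sliceFun F j a) 0 (fun _ ↦ a j) = dbar F j a := by
  set L : ℂ →L[ℝ] (Fin n → ℂ) :=
    ContinuousLinearMap.pi (Pi.single j (ContinuousLinearMap.id ℝ ℂ)) with hL
  have hupd : HasFDerivAt (fun u : Fin 1 → ℂ ↦ Function.update a j (u 0))
      (L.comp (ContinuousLinearMap.proj 0)) (fun _ ↦ a j) :=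
    HasFDerivAt.comp (g := Function.update a j) (f := fun u : Fin 1 → ℂ ↦ u 0) (fun _ ↦ a j)
      (hasFDerivAt_update a (a j)) (hasFDerivAt_apply 0 _)
  have hsingle (s : ℂ) : L s = Pi.single j s := by
    ext i
    by_cases h : i = j
    · subst h
      simp [hL]
    · simp [hL, h]
  have hF' : HasFDerivAt F (fderiv ℝ F a) (Function.update a j ((fun _ : Fin 1 ↦ a j) 0)) := by
    rw [Function.update_eq_self]
    exact hF.hasFDerivAt
  have hfd : fderiv ℝ (sliceFun F j a) (fun _ ↦ a j) = _ := (hF'.comp (fun _ ↦ a j) hupd).fderiv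
  simp [dbar, hfd, hsingle]

/-- **Hartogs' theorem** for functions with values in `𝕆_ℂ`. -/
theorem isHolomorphic_of_separately {D : Set (Fin n → ℂ)} (hD : IsOpen D)
    {F : (Fin n → ℂ) → OctonionC}
    (hsep : ∀ (a : Fin n → ℂ) (j : Fin n), IsHolomorphic (sliceSet D j a) (sliceFun F j a)) :
    IsHolomorphic D F := by
  have hmem {a : Fin n → ℂ} (ha : a ∈ D) (j : Fin n) : (fun _ ↦ a j) ∈ sliceSet D j a := by
    change Function.update a j (a j) ∈ D
    rwa [Function.update_eq_self]
  -- Joint regularity has to come before the equations: the chain rule identifying `dbar F j a` with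
  -- the slice derivative needs `F` differentiable at `a`.
  have hC : ContDiffOn ℝ 1 F D := by
    refine contDiffOn_of_differentiableOn_complexCoord hD fun l a ha ↦ ?_
    refine DifferentiableAt.differentiableWithinAt ?_
    refine differentiableAt_pi_of_separately hD (u := fun z ↦ complexCoord l (F z))
      (fun a ha j ↦ ?_) ha
    exact (hsep a j).differentiableAt_complexCoord (isOpen_sliceSet hD j a) l (hmem ha j)
  refine ⟨hC, fun a ha j ↦ ?_⟩
  rw [← dbar_sliceFun
    ((hC.differentiableOn (by norm_num)).differentiableAt (hD.mem_nhds ha)) j]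
  exact (hsep a j).2 _ (hmem ha j) 0

end SliceOctonion

end

theorem mainTheorem4 (n : ℕ) (D : Set (Fin n → ℂ)) (hD : IsOpen D)
    (F : (Fin n → ℂ) → OctonionC) (hF : IsStem D F)
    (f : circularSet D → Octonion) (hf : IsInducedBy D F f)
    (hsep : ∀ (a : Fin n → ℂ) (j : Fin n), IsHolomorphic (sliceSet D j a) (sliceFun F j a)) :
    IsSliceRegular D f :=
  ⟨F, hF, hf, isHolomorphic_of_separately hD hsep⟩
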